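/- Let $\Gamma$ be a finite connected regular graph with vertex set $V$, degree $k$ and $n=|V|$ vertices, whose adjacency matrix has exactly four distinct eigenvalues $\theta_0=k>\theta_1>\theta_2>\theta_3$, and let $m_i$ be the multiplicity of $\theta_i$ (so $m_0=1$). Put $\overline{\mathcal C}_\ell=\frac1n\sum_{i=0}^3 m_i\theta_i^\ell$ and let $$\gamma_2=\frac{\overline{\mathcal C}_3^{\,2}-\overline{\mathcal C}_4\,k+k^3}{k(\overline{\mathcal C}_3+k-k^2)}$$ be the (second) preintersection number of $\Gamma$. Let $k_3(u)$ be the number of vertices at distance $3$ from the vertex $u$, and let $\overline{k_3}=\frac1n\sum_{u\in V}k_3(u)$. Consider the polynomials $$s_1(x)=x^2-(\theta_1+\theta_3-\gamma_2)x+\gamma_2+\theta_2(\theta_1-\theta_2+\theta_3),$$ $$s_2(x)=x^2-(\theta_1+\theta_2-\gamma_2)x+\gamma_2+\theta_3(\theta_1-\theta_3+\theta_2),$$ and, for $j=1,2$, the constants $$\tau_j=\frac{s_j(\theta_0)\sum_{i=1}^3 m_i s_j(\theta_i)-\sum_{i=1}^3 m_i s_j(\theta_i)^2}{s_j(\theta_0)(n-1)-\sum_{i=1}^3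 m_i s_j(\theta_i)}$$ (with $\tau_j=0$ should the denominator vanish). Then $$\overline{k_3}\le \frac{n\sum_{i=1}^3 m_i(s_j(\theta_i)-\tau_j)^2}{\sum_{i=0}^3 m_i(s_j(\theta_i)-\tau_j)^2},\qquad j=1,2.$$ Equality holds for some $j\in\{1,2\}$ if and only if $\Gamma$ is distance-regular and its distance-2 graph $\Gamma_2$ (same vertices, two vertices being adjacent when they are at distance $2$ in $\Gamma$) is strongly regular, that is, neither complete nor edgeless, regular, and such that the number of common neighbours of two distinct vertices depends only on whether they are adjacent (disjoint unions of complete graphs of equal size being allowed). Moreover, if equality holds for $j$, then $k_3(u)=\overline{k_3}$ for every vertex $u$, and the set of eigenvalues of $\Gamma_2$ is $\{\lambda_0,\lambda_1,\lambda_2\}$, where $\lambda_0=n-\overline{k_3}-\theta_0-1$ and $$\lambda_1=\frac{(\theta_1-\theta_2)(\theta_2-\theta_3)-\tau_1}{\gamma_2},\quad \lambda_2=-\frac{\tau_1}{\gamma_2}\qquad\text{if } j=1,$$ $$\lambda_1=-\frac{\tau_2}{\gamma_2},\quad \lambda_2=\frac{(\theta_1-\theta_3)(\theta_3-\theta_2)-\tau_2}{\gamma_2}\qquad\text{if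 } j=2.$$ -/

import Mathlib

open Polynomial

noncomputable section

namespace SimpleGraph

variable {V : Type*} (G : SimpleGraph V)

/-- The distance-`i` graph: two distinct vertices are adjacent when they are at distance `i`
in `G`. (It is only used for connected `G`, so the junk value of `dist` plays no role.) -/
def distanceGraph (i : ℕ) : SimpleGraph V where
  Adj u v := u ≠ v ∧ G.dist u v = i
  symm := ⟨fun _ _ h => ⟨h.1.symm, G.dist_comm ▸ h.2⟩⟩
  loopless := ⟨fun _ h => h.1 rfl⟩

instance distanceGraph_decidableRel [DecidableEq V] (i : ℕ) :
    DecidableRel (G.distanceGraph i).Adj :=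
  fun u v => inferInstanceAs (Decidable (u ≠ v ∧ G.dist u v = i))

/-- A connected graph is distance-regular when, for any two vertices `u`, `v` at distance `i`,
the number of neighbours of `v` at distance `i - 1` from `u` and the number of those at distance
`i + 1` from `u` depend only on `i`. (For `i = 0` the second condition says that `G` is regular, so
that the number of neighbours of `v` at distance `i` from `u` depends only on `i` as well.) -/
def IsDistanceRegular : Prop :=
  G.Connected ∧ ∃ b c : ℕ → ℕ, ∀ u v : V,
    {w | G.Adj v w ∧ G.dist u w + 1 = G.dist u v}.ncard = c (G.dist u v) ∧
    {w | G.Adj v w ∧ G.dist u w = G.dist u v + 1}.ncard = b (G.dist u v)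

variable [Fintype V] [DecidableEq V] [DecidableRel G.Adj]

/-- A graph is strongly regular when it is neither edgeless nor complete and satisfies
`IsSRGWith` for some parameters (disjoint unions of equal complete graphs are allowed). -/
def IsStronglyRegular : Prop :=
  G ≠ ⊥ ∧ G ≠ ⊤ ∧ ∃ k l m : ℕ, G.IsSRGWith (Fintype.card V) k l m

/-- The multiplicity of `x` as an eigenvalue of the (symmetric) adjacency matrix. -/
def eigMult (x : ℝ) : ℕ :=
  Module.finrank ℝ (Module.End.eigenspace (Matrix.toLin' (G.adjMatrix ℝ)) x)

/-- The number of vertices at distance `3` from `u`. -/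
def k3 (u : V) : ℕ := {v | G.dist u v = 3}.ncard

/-- The average, over all vertices `u`, of the number of vertices at distance `3` from `u`. -/
def avgK3 : ℝ := (∑ u : V, (G.k3 u : ℝ)) / (Fintype.card V : ℝ)

/-- The average number of circuits (closed walks) of length `l` rooted at a vertex, for a graph
with distinct eigenvalues `θ 0, …, θ 3`:  `(1 / n) ∑ i, mᵢ θᵢ ^ l`. -/
def avgCircuits (θ : Fin 4 → ℝ) (l : ℕ) : ℝ :=
  (∑ i, (G.eigMult (θ i) : ℝ) * θ i ^ l) / (Fintype.card V : ℝ)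

/-- The preintersection number `γ₂` of a `k`-regular graph, from the spectrum. -/
def preintersection2 (k : ℕ) (θ : Fin 4 → ℝ) : ℝ :=
  (G.avgCircuits θ 3 ^ 2 - G.avgCircuits θ 4 * k + (k : ℝ) ^ 3) /
    (k * (G.avgCircuits θ 3 + k - (k : ℝ) ^ 2))

/-- The constant `τ` attached to a polynomial `s`; the sums are over `i = 1, 2, 3`. -/
def tau (θ : Fin 4 → ℝ) (s : ℝ[X]) : ℝ :=
  (s.eval (θ 0) * (∑ i : Fin 3, (G.eigMult (θ i.succ) : ℝ) * s.eval (θ i.succ))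
      - ∑ i : Fin 3, (G.eigMult (θ i.succ) : ℝ) * s.eval (θ i.succ) ^ 2) /
    (s.eval (θ 0) * ((Fintype.card V : ℝ) - 1)
      - ∑ i : Fin 3, (G.eigMult (θ i.succ) : ℝ) * s.eval (θ i.succ))

/-- The spectral expression `n ∑_{i=1}^3 mᵢ (s(θᵢ) - t)² / ∑_{i=0}^3 mᵢ (s(θᵢ) - t)²`. -/
def excessBound (θ : Fin 4 → ℝ) (s : ℝ[X]) (t : ℝ) : ℝ :=
  ((Fintype.card V : ℝ) *
      ∑ i : Fin 3, (G.eigMult (θ i.succ) : ℝ) * (s.eval (θ i.succ) - t) ^ 2) /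
    (∑ i : Fin 4, (G.eigMult (θ i) : ℝ) * (s.eval (θ i) - t) ^ 2)

end SimpleGraph

/-- The quadratic `s₁`, with `g` in the place of `γ₂`. -/
def s1Poly (θ : Fin 4 → ℝ) (g : ℝ) : ℝ[X] :=
  X ^ 2 - C (θ 1 + θ 3 - g) * X + C (g + θ 2 * (θ 1 - θ 2 + θ 3))

/-- The quadratic `s₂`, with `g` in the place of `γ₂`. -/
def s2Poly (θ : Fin 4 → ℝ) (g : ℝ) : ℝ[X] :=
  X ^ 2 - C (θ 1 + θ 2 - g) * X + C (g + θ 3 * (θ 1 - θ 3 + θ 2))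

end

/-! For a quadratic `p`, the matrix `p(A)` vanishes on pairs at distance 3. It has all row sums `p(θ
0)`, and the sum of its squared entries is `tr p(A)² = ∑ mᵢ p(θᵢ)²`. Cauchy–Schwarz over the `n(n -
avgK3)` pairs at distance at most 2, with `p = s - t`, is the bound, for every real `t`. Equality
means that `p(A) = c(I + A + A₂)`, that is, `A² = kI + aA + cA₂` for suitable `a` and `c`.

This relation carries the rest. Traces identify `c` with `γ₂`. The cubic with roots `θ 1, θ 2, θ 3`
takes `A` to a multiple of `J`, so all `AᵢA` depend only on distance and the graph is
distance-regular. Moreover `A₂ = P(A)` with `P` quadratic, and the linear coefficient of `s_j`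
forces `P` to agree at two of `θ 1, θ 2, θ 3`, so `A₂` satisfies a quadratic equation modulo `J`.

Conversely, distance-regularity gives the relation, and strong regularity of `Γ₂` lets `P` take at
most two values on `θ 1, θ 2, θ 3`. Two of these values coincide, so two of the `θᵢ` add up to `a`.
A trace argument excludes `θ 2 + θ 3 = a`; the other two cases are equality for `s₁` and for `s₂`.
-/

namespace Matrix.IsHermitian

/-! ### Polynomials in a real symmetric matrix -/

variable {m : Type*} [Fintype m] [DecidableEq m] {A : Matrix m m ℝ}

theorem aeval_eq_conj_diagonal (hA : A.IsHermitian) (p : ℝ[X]) :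
    aeval A p = Unitary.conjStarAlgAut ℝ _ hA.eigenvectorUnitary
      (diagonal fun i => p.eval (hA.eigenvalues i)) := by
  have h := hA.spectral_theorem
  have hd : aeval (diagonal (RCLike.ofReal ∘ hA.eigenvalues) : Matrix m m ℝ) p =
      diagonal fun i => p.eval (hA.eigenvalues i) := by
    have := aeval_algHom_apply (diagonalAlgHom ℝ : (m → ℝ) →ₐ[ℝ] _) hA.eigenvalues p
    simp only [diagonalAlgHom_apply] at this
    refine Eq.trans this ?_
    congr 1
    ext i
    simp [← Pi.evalAlgHom_apply ℝ (fun _ => ℝ) i (aeval hA.eigenvalues p), ← aeval_algHom_apply,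
      -Pi.evalAlgHom_apply]
    simp
  rw [← hd]
  conv_lhs => rw [h]
  exact aeval_algHom_apply (Unitary.conjStarAlgAut ℝ _ hA.eigenvectorUnitary :
    Matrix m m ℝ →ₐ[ℝ] Matrix m m ℝ) _ p

theorem trace_aeval (hA : A.IsHermitian) (p : ℝ[X]) :
    (aeval A p).trace = ∑ i, p.eval (hA.eigenvalues i) := by
  rw [hA.aeval_eq_conj_diagonal, Unitary.conjStarAlgAut_apply, trace_mul_comm, ← mul_assoc]
  simp

theorem aeval_eq_zero_of_spectrum (hA : A.IsHermitian) (p : ℝ[X])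
    (hp : ∀ x ∈ spectrum ℝ A, p.eval x = 0) : aeval A p = 0 := by
  rw [hA.aeval_eq_conj_diagonal]
  simp [hp _ (hA.eigenvalues_mem_spectrum_real _)]

theorem spectrum_aeval (hA : A.IsHermitian) (p : ℝ[X]) :
    spectrum ℝ (aeval A p) = (fun x => p.eval x) '' spectrum ℝ A := by
  rw [hA.aeval_eq_conj_diagonal, AlgEquiv.spectrum_eq, spectrum_diagonal,
    hA.spectrum_real_eq_range_eigenvalues, ← Set.range_comp]
  rfl

/-- Rank–nullity for `A - x`, whose rank counts the nonzero diagonal entries after diagonalization.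
-/
theorem finrank_eigenspace_toLin' (hA : A.IsHermitian) (x : ℝ) :
    Module.finrank ℝ (Module.End.eigenspace (toLin' A) x) =
      (Finset.univ.filter fun i => hA.eigenvalues i = x).card := by
  have hker : Module.End.eigenspace (toLin' A) x = LinearMap.ker (aeval A (X - C x)).mulVecLin := by
    ext v
    simp [sub_eq_zero, Algebra.algebraMap_eq_smul_one]
  have hrank : (aeval A (X - C x)).rank =
      (Finset.univ.filter fun i => hA.eigenvalues i ≠ x).card := by
    rw [hA.aeval_eq_conj_diagonal, Unitary.conjStarAlgAut_apply, ← Unitary.coe_star]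
    simp [-isUnit_iff_ne_zero, -Unitary.coe_star, rank_diagonal, sub_eq_zero,
      Fintype.card_subtype]
  have h := (aeval A (X - C x)).mulVecLin.finrank_range_add_finrank_ker
  have h' := Finset.card_filter_add_card_filter_not (s := Finset.univ)
    (fun i => hA.eigenvalues i = x)
  rw [← hker] at h
  rw [rank] at hrank
  simp at h h' hrank
  omega

theorem trace_aeval_eq_sum_finrank {ι : Type*} [Fintype ι] [DecidableEq ι] (hA : A.IsHermitian)
    (θ : ι → ℝ) (hθ : Function.Injective θ) (hspec : spectrum ℝ A = Set.range θ) (p : ℝ[X]) :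
    (aeval A p).trace = ∑ j,
      (Module.finrank ℝ (Module.End.eigenspace (toLin' A) (θ j)) : ℝ) * p.eval (θ j) := by
  rw [hA.trace_aeval]
  have : ∀ i, ∃ j, θ j = hA.eigenvalues i := fun i => by
    have := hA.eigenvalues_mem_spectrum_real i
    rwa [hspec] at this
  choose f hf using this
  rw [← Finset.sum_fiberwise Finset.univ f]
  refine Finset.sum_congr rfl fun j _ => ?_
  rw [hA.finrank_eigenspace_toLin', ← nsmul_eq_mul, ← Finset.sum_const]
  have : (Finset.univ.filter fun i => f i = j) =
      Finset.univ.filter fun i => hA.eigenvalues i = θ j := by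
    ext i
    simp [← hf, hθ.eq_iff]
  rw [this]
  refine Finset.sum_congr rfl fun i hi => ?_
  rw [(Finset.mem_filter.mp hi).2]

end Matrix.IsHermitian

/-! ### Polynomials in the adjacency matrix of a connected regular graph -/

namespace SimpleGraph

open scoped Matrix

variable {V : Type*} [Fintype V] [DecidableEq V] {G : SimpleGraph V} [DecidableRel G.Adj]

theorem aeval_adjMatrix_row_sum {k : ℕ} (hreg : G.IsRegularOfDegree k) (p : ℝ[X]) (u : V) :
    ∑ v, aeval (G.adjMatrix ℝ) p u v = p.eval (k : ℝ) := by
  suffices h : aeval (G.adjMatrix ℝ) p *ᵥ (fun _ => (1 : ℝ)) = fun _ => p.eval (k : ℝ) by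
    simpa [Matrix.mulVec, dotProduct] using congrFun h u
  induction p using Polynomial.induction_on' with
  | add p q hp hq =>
    rw [map_add, Matrix.add_mulVec, hp, hq]
    ext; simp
  | monomial n a =>
    induction n generalizing a with
    | zero =>
      ext
      simp [Algebra.algebraMap_eq_smul_one, Matrix.smul_mulVec]
    | succ n ih =>
      rw [← monomial_mul_X, map_mul, aeval_X, ← Matrix.mulVec_mulVec]
      have : G.adjMatrix ℝ *ᵥ (fun _ => (1 : ℝ)) = (k : ℝ) • fun _ => (1 : ℝ) := by
        ext v
        simp [hreg.degree_eq v]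
      rw [this, Matrix.mulVec_smul, ih]
      ext
      simp
      ring

/-- By regularity the Laplacian is `k - A`, and its kernel consists of the functions constant on
components. -/
theorem const_of_adjMatrix_mulVec_eq {k : ℕ} (hconn : G.Connected)
    (hreg : G.IsRegularOfDegree k) {x : V → ℝ} :
    G.adjMatrix ℝ *ᵥ x = (k : ℝ) • x ↔ ∀ u v, x u = x v := by
  have : G.adjMatrix ℝ *ᵥ x = (k : ℝ) • x ↔ G.lapMatrix ℝ *ᵥ x = 0 := by
    have hd : G.degMatrix ℝ *ᵥ x = (k : ℝ) • x := by
      ext v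
      simp [degMatrix_mulVec_apply, hreg.degree_eq v]
    rw [lapMatrix, Matrix.sub_mulVec, hd, sub_eq_zero, eq_comm]
  rw [this, lapMatrix_mulVec_eq_zero_iff_forall_reachable]
  exact ⟨fun h u v => h u v (hconn.preconnected u v), fun h u v _ => h u v⟩

theorem eigMult_degree {k : ℕ} (hconn : G.Connected) (hreg : G.IsRegularOfDegree k) :
    G.eigMult (k : ℝ) = 1 := by
  obtain ⟨v₀⟩ := hconn.nonempty
  rw [eigMult, finrank_eq_one_iff']
  have hmem : ∀ x, x ∈ Module.End.eigenspace (Matrix.toLin' (G.adjMatrix ℝ)) (k : ℝ) ↔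
      ∀ u v, x u = x v := fun x => by
    rw [Module.End.mem_eigenspace_iff, Matrix.toLin'_apply,
      const_of_adjMatrix_mulVec_eq hconn hreg]
  refine ⟨⟨fun _ => 1, (hmem _).2 fun _ _ => rfl⟩, ?_, ?_⟩
  · intro h
    simpa using congrFun (congrArg Subtype.val h) v₀
  · rintro ⟨w, hw⟩
    refine ⟨w v₀, Subtype.ext ?_⟩
    ext v
    simpa using (hmem _).1 hw v₀ v

/-- A polynomial that vanishes on all eigenvalues other than the degree takes the adjacency matrix
to a multiple of the all-ones matrix. -/
theorem aeval_adjMatrix_const {k : ℕ} (hconn : G.Connected) (hreg : G.IsRegularOfDegree k)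
    (p : ℝ[X]) (hp : ∀ x ∈ spectrum ℝ (G.adjMatrix ℝ), x ≠ k → p.eval x = 0) (u v : V) :
    aeval (G.adjMatrix ℝ) p u v = p.eval (k : ℝ) / Fintype.card V := by
  set A := G.adjMatrix ℝ with hA
  -- The extra factor kills the one eigenvalue where `p` may survive. Hence rows and columns of
  -- `p(A)` are `k`-eigenvectors, so constant, and the row sum gives the value.
  have h0 : aeval A ((X - C (k : ℝ)) * p) = 0 := by
    refine (isHermitian_adjMatrix (R := ℝ) (G := G)).aeval_eq_zero_of_spectrum _ fun x hx => ?_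
    by_cases h : x = k
    · simp [h]
    · simp [hp x hx h]
  have h1 : A * aeval A p = (k : ℝ) • aeval A p := by
    simpa only [map_mul, map_sub, aeval_X, aeval_C, sub_mul, sub_eq_zero,
      Algebra.algebraMap_eq_smul_one, smul_mul_assoc, one_mul] using h0
  have h2 : aeval A p * A = (k : ℝ) • aeval A p := by
    rw [← h1]
    simpa using congrArg (aeval A) (mul_comm p X)
  have hc : ∀ v u u', aeval A p u v = aeval A p u' v := fun v => by
    have := (const_of_adjMatrix_mulVec_eq hconn hreg (x := fun u => aeval A p u v)).1 (by
      ext u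
      simpa [hA, Matrix.mul_apply, Matrix.mulVec, dotProduct] using congrFun (congrFun h1 u) v)
    exact this
  have hr : ∀ u v v', aeval A p u v = aeval A p u v' := fun u => by
    have := (const_of_adjMatrix_mulVec_eq hconn hreg (x := fun v => aeval A p u v)).1 (by
      ext v
      have := congrFun (congrFun h2 u) v
      simp only [Matrix.mul_apply, Matrix.smul_apply, smul_eq_mul] at this
      simp only [Matrix.mulVec, dotProduct, Pi.smul_apply, smul_eq_mul, ← this]
      refine Finset.sum_congr rfl fun w _ => ?_
      rw [mul_comm, hA, ← (G.isSymm_adjMatrix (α := ℝ)).apply])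
    exact this
  have hs := aeval_adjMatrix_row_sum hreg p u
  rw [Finset.sum_congr rfl fun w _ => hr u w v] at hs
  have := hconn.nonempty
  rw [eq_div_iff (by positivity), ← hs]
  simp [mul_comm]

theorem aeval_adjMatrix_eq_zero_of_lt_dist (p : ℝ[X]) {u v : V} (h : p.natDegree < G.dist u v) :
    aeval (G.adjMatrix ℝ) p u v = 0 := by
  rw [aeval_eq_sum_range, Matrix.sum_apply]
  refine Finset.sum_eq_zero fun i hi => ?_
  rw [Matrix.smul_apply, adjMatrix_pow_apply_eq_card_walk]
  have : IsEmpty {q : G.Walk u v | q.length = i} := ⟨fun q => by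
    have h1 := dist_le q.1
    have h2 : q.1.length = i := q.2
    have := Finset.mem_range.1 hi
    omega⟩
  simp [Fintype.card_eq_zero]

theorem one_le_adjMatrix_sq (hconn : G.Connected) {u v : V} (h : G.dist u v = 2) :
    1 ≤ (G.adjMatrix ℝ * G.adjMatrix ℝ) u v := by
  obtain ⟨q, hq⟩ := hconn.exists_walk_length_eq_dist u v
  rw [← pow_two, adjMatrix_pow_apply_eq_card_walk]
  have : Nonempty {q : G.Walk u v | q.length = 2} := ⟨⟨q, hq.trans h⟩⟩
  exact_mod_cast Fintype.card_pos

/-- The monic cubic with roots `θ 1, θ 2, θ 3` gives a nonzero multiple of `J`, yet its entry at a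
pair farther apart than 3 would be zero. -/
theorem dist_le_three {k : ℕ} (hconn : G.Connected) (hreg : G.IsRegularOfDegree k)
    {θ : Fin 4 → ℝ} (hθ : StrictAnti θ) (hθ0 : θ 0 = k)
    (hspec : spectrum ℝ (G.adjMatrix ℝ) = Set.range θ) (u v : V) : G.dist u v ≤ 3 := by
  by_contra! h
  have hp : (∏ i : Fin 3, (X - C (θ i.succ))).natDegree = 3 := by
    simp [natDegree_prod_of_monic _ _ fun (i : Fin 3) _ => monic_X_sub_C (θ i.succ)]
  have h1 := aeval_adjMatrix_const hconn hreg (∏ i : Fin 3, (X - C (θ i.succ))) (by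
    rw [hspec]
    rintro _ ⟨i, rfl⟩ hi
    rw [eval_prod]
    refine Fin.cases (fun h => (h hθ0).elim) (fun j _ => ?_) i hi
    exact Finset.prod_eq_zero (Finset.mem_univ j) (by simp)) u v
  rw [aeval_adjMatrix_eq_zero_of_lt_dist _ (by omega)] at h1
  have := hconn.nonempty
  rw [eq_comm, div_eq_zero_iff, eval_prod, Finset.prod_eq_zero_iff] at h1
  rcases h1 with ⟨i, -, hi⟩ | h1
  · have := hθ (Fin.succ_pos i)
    simp only [eval_sub, eval_X, eval_C] at hi
    linarith
  · simp at h1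

theorem aeval_adjMatrix_ne_zero [Nonempty V] {θ : Fin 4 → ℝ} (hθ : StrictAnti θ)
    (hspec : spectrum ℝ (G.adjMatrix ℝ) = Set.range θ) {p : ℝ[X]} (hp : p ≠ 0)
    (hdeg : p.natDegree ≤ 3) : aeval (G.adjMatrix ℝ) p ≠ 0 := by
  intro h
  have hs := (isHermitian_adjMatrix (R := ℝ) (G := G)).spectrum_aeval p
  rw [h, spectrum.zero_eq, hspec] at hs
  refine hp (eq_zero_of_natDegree_lt_card_of_eval_eq_zero p hθ.injective (fun i => ?_)
    (by simpa using Nat.lt_succ_of_le hdeg))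
  have : p.eval (θ i) ∈ ({0} : Set ℝ) := hs ▸ ⟨θ i, ⟨i, rfl⟩, rfl⟩
  exact this

theorem exists_dist_eq_two (hconn : G.Connected) (hne : ∃ u v, u ≠ v ∧ ¬ G.Adj u v) :
    ∃ u v, G.dist u v = 2 := by
  by_contra! h
  obtain ⟨u, v, huv, hadj⟩ := hne
  have key : ∀ {u v : V}, G.Walk u v → u = v ∨ G.Adj u v := by
    intro u v q
    induction q with
    | nil => exact Or.inl rfl
    | @cons u w v hu q ih =>
      rcases ih with rfl | ih
      · exact Or.inr hu
      · by_contra! hc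
        have h1 := dist_le (Walk.cons hu (Walk.cons ih Walk.nil))
        have h2 := hconn.pos_dist_of_ne hc.1
        have h3 : G.dist u v ≠ 1 := fun h => hc.2 (dist_eq_one_iff_adj.1 h)
        have h4 := h u v
        simp at h1
        omega
  obtain ⟨q⟩ := hconn.preconnected u v
  exact (key q).elim huv hadj

/-- Otherwise the graph is complete and `A + 1 = J`; then `J² = nJ` gives a quadratic annihilating
`A`, against four distinct eigenvalues. -/
theorem exists_dist_eq_two_of_spectrum (hconn : G.Connected) {θ : Fin 4 → ℝ} (hθ : StrictAnti θ)
    (hspec : spectrum ℝ (G.adjMatrix ℝ) = Set.range θ) : ∃ u v, G.dist u v = 2 := by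
  refine exists_dist_eq_two hconn ?_
  by_contra! h
  have := hconn.nonempty
  have hA : G.adjMatrix ℝ + 1 = Matrix.of fun _ _ => (1 : ℝ) := by
    ext u v
    by_cases huv : u = v
    · simp [huv]
    · simp [huv, h u v huv]
  have hmon : ((X + C 1) * (X + C 1 - C (Fintype.card V : ℝ)) : ℝ[X]).Monic := by
    rw [add_sub_assoc, ← C_sub]
    exact (monic_X_add_C _).mul (monic_X_add_C _)
  refine aeval_adjMatrix_ne_zero hθ hspec hmon.ne_zero ?_ ?_
  · rw [add_sub_assoc, ← C_sub]
    refine natDegree_mul_le.trans ?_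
    rw [natDegree_X_add_C, natDegree_X_add_C]
    simp
  · simp only [map_mul, map_sub, map_add, aeval_X, aeval_C, map_one, hA, mul_sub,
      Algebra.algebraMap_eq_smul_one, mul_smul_comm, mul_one]
    ext u v
    simp [Matrix.mul_apply]

end SimpleGraph

/-! ### The inequality and its equality criterion -/

namespace SimpleGraph

open scoped Matrix

section

variable {V : Type*} [Fintype V] {G : SimpleGraph V}

theorem sum_dist_le_two (h3 : ∀ u v, G.dist u v ≤ 3) (u : V) :
    (∑ v, if G.dist u v ≤ 2 then (1 : ℝ) else 0) = Fintype.card V - G.k3 u := by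
  have h : ∀ v, (if G.dist u v ≤ 2 then (1 : ℝ) else 0) =
      1 - if G.dist u v = 3 then (1 : ℝ) else 0 := fun v => by
    have := h3 u v
    by_cases h : G.dist u v = 3
    · simp [h]
    · simp [h, show G.dist u v ≤ 2 by omega]
  simp [h, k3, Set.ncard_eq_toFinset_card', Finset.sum_boole]

theorem sum_k3 [Nonempty V] : ∑ u, (G.k3 u : ℝ) = Fintype.card V * G.avgK3 := by
  rw [avgK3, mul_div_cancel₀ _ (by simp)]

theorem avgK3_lt [Nonempty V] : G.avgK3 < Fintype.card V := by
  rw [avgK3, div_lt_iff₀ (by positivity)]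
  have h : ∀ u, (G.k3 u : ℝ) < Fintype.card V := fun u => by
    rw [← Nat.card_eq_fintype_card, ← Set.ncard_univ]
    refine Nat.cast_lt.2 (Set.ncard_lt_ncard ?_)
    rw [Set.ssubset_univ_iff, Ne, Set.eq_univ_iff_forall]
    intro h
    simpa using h u
  refine (Finset.sum_lt_sum_of_nonempty Finset.univ_nonempty fun u _ => h u).trans_eq ?_
  simp

end

variable {V : Type*} [Fintype V] [DecidableEq V] {G : SimpleGraph V} [DecidableRel G.Adj]

/-- A connected `k`-regular graph whose distinct eigenvalues are `k = θ 0 > θ 1 > θ 2 > θ 3`. -/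
structure HasFourEigenvalues (G : SimpleGraph V) [DecidableRel G.Adj] (k : ℕ)
    (θ : Fin 4 → ℝ) : Prop where
  connected : G.Connected
  regular : G.IsRegularOfDegree k
  strictAnti : StrictAnti θ
  zero_eq : θ 0 = k
  spectrum_eq : spectrum ℝ (G.adjMatrix ℝ) = Set.range θ

theorem transpose_aeval_adjMatrix (p : ℝ[X]) :
    (aeval (G.adjMatrix ℝ) p)ᵀ = aeval (G.adjMatrix ℝ) p := by
  simp [aeval_eq_sum_range, Matrix.transpose_sum, Matrix.transpose_pow]

theorem trace_aeval_adjMatrix_sq (p : ℝ[X]) :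
    (aeval (G.adjMatrix ℝ) (p ^ 2)).trace = ∑ u, ∑ v, aeval (G.adjMatrix ℝ) p u v ^ 2 := by
  simp only [pow_two, map_mul, Matrix.trace, Matrix.diag_apply, Matrix.mul_apply]
  refine Finset.sum_congr rfl fun u _ => Finset.sum_congr rfl fun v _ => ?_
  congr 1
  rw [← Matrix.transpose_apply (aeval (G.adjMatrix ℝ) p), transpose_aeval_adjMatrix]

namespace HasFourEigenvalues

variable {k : ℕ} {θ : Fin 4 → ℝ}

theorem trace_aeval (hG : G.HasFourEigenvalues k θ) (p : ℝ[X]) :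
    (aeval (G.adjMatrix ℝ) p).trace = ∑ i, (G.eigMult (θ i) : ℝ) * p.eval (θ i) :=
  (isHermitian_adjMatrix (R := ℝ) (G := G)).trace_aeval_eq_sum_finrank θ
    hG.strictAnti.injective hG.spectrum_eq p

theorem eigMult_zero (hG : G.HasFourEigenvalues k θ) : G.eigMult (θ 0) = 1 := by
  rw [hG.zero_eq, eigMult_degree hG.connected hG.regular]

theorem sum_succ (hG : G.HasFourEigenvalues k θ) (p : ℝ[X]) :
    ∑ i : Fin 3, (G.eigMult (θ i.succ) : ℝ) * p.eval (θ i.succ) =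
      (aeval (G.adjMatrix ℝ) p).trace - p.eval (θ 0) := by
  rw [hG.trace_aeval, Fin.sum_univ_succ (n := 3), hG.eigMult_zero]
  simp

theorem dist_le (hG : G.HasFourEigenvalues k θ) (u v : V) : G.dist u v ≤ 3 :=
  dist_le_three hG.connected hG.regular hG.strictAnti hG.zero_eq hG.spectrum_eq u v

theorem trace_sq_pos (hG : G.HasFourEigenvalues k θ) {p : ℝ[X]} (hp : p ≠ 0)
    (hdeg : p.natDegree ≤ 3) : 0 < (aeval (G.adjMatrix ℝ) (p ^ 2)).trace := by
  have := hG.connected.nonempty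
  rw [trace_aeval_adjMatrix_sq]
  refine lt_of_le_of_ne (by positivity) fun h => ?_
  refine aeval_adjMatrix_ne_zero hG.strictAnti hG.spectrum_eq hp hdeg ?_
  ext u v
  rw [eq_comm, Finset.sum_eq_zero_iff_of_nonneg fun _ _ => by positivity] at h
  have := h u (Finset.mem_univ u)
  rw [Finset.sum_eq_zero_iff_of_nonneg fun _ _ => by positivity] at this
  simpa using this v (Finset.mem_univ v)

theorem sum_near (hG : G.HasFourEigenvalues k θ) :
    (∑ u, ∑ v, if G.dist u v ≤ 2 then (1 : ℝ) else 0) =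
      Fintype.card V * (Fintype.card V - G.avgK3) := by
  have := hG.connected.nonempty
  simp only [sum_dist_le_two hG.dist_le, Finset.sum_sub_distrib, sum_k3]
  simp
  ring

/-- Because `p` has degree at most 2, pairs at distance 3 contribute nothing to the row sums and to
the trace, so the sum over near pairs expands into spectral data. -/
theorem sum_near_sub_sq (hG : G.HasFourEigenvalues k θ) {p : ℝ[X]} (hdeg : p.natDegree ≤ 2)
    (c : ℝ) :
    (∑ u, ∑ v, if G.dist u v ≤ 2 then (aeval (G.adjMatrix ℝ) p u v - c) ^ 2 else 0) =
      (aeval (G.adjMatrix ℝ) (p ^ 2)).trace - 2 * c * (Fintype.card V * p.eval (θ 0)) +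
        c ^ 2 * (Fintype.card V * (Fintype.card V - G.avgK3)) := by
  have h : ∀ u v, (if G.dist u v ≤ 2 then (aeval (G.adjMatrix ℝ) p u v - c) ^ 2 else 0) =
      aeval (G.adjMatrix ℝ) p u v ^ 2 - 2 * c * aeval (G.adjMatrix ℝ) p u v +
        c ^ 2 * if G.dist u v ≤ 2 then (1 : ℝ) else 0 := fun u v => by
    split_ifs with h
    · ring
    · rw [aeval_adjMatrix_eq_zero_of_lt_dist p (by omega)]
      ring
  simp only [h, Finset.sum_add_distrib, Finset.sum_sub_distrib, ← Finset.mul_sum,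
    ← trace_aeval_adjMatrix_sq, aeval_adjMatrix_row_sum hG.regular, hG.sum_near, hG.zero_eq]
  simp

theorem excessBound_eq (hG : G.HasFourEigenvalues k θ) (s : ℝ[X]) (t : ℝ) :
    G.excessBound θ s t = Fintype.card V *
      ((aeval (G.adjMatrix ℝ) ((s - C t) ^ 2)).trace - (s - C t).eval (θ 0) ^ 2) /
        (aeval (G.adjMatrix ℝ) ((s - C t) ^ 2)).trace := by
  rw [excessBound, ← eval_pow, ← hG.sum_succ, hG.trace_aeval]
  simp

theorem sub_C_ne_zero {s : ℝ[X]} (hs : s.natDegree = 2) (t : ℝ) : s - C t ≠ 0 := by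
  intro h
  rw [← natDegree_sub_C (a := t), h] at hs
  simp at hs

/-- The difference of the two sides of the Cauchy–Schwarz inequality, as a sum of squares. -/
theorem sum_near_sub_mean_sq (hG : G.HasFourEigenvalues k θ) {s : ℝ[X]} (hs : s.natDegree = 2)
    (t : ℝ) :
    (∑ u, ∑ v, if G.dist u v ≤ 2 then (aeval (G.adjMatrix ℝ) (s - C t) u v -
        (s - C t).eval (θ 0) / (Fintype.card V - G.avgK3)) ^ 2 else 0) =
      (aeval (G.adjMatrix ℝ) ((s - C t) ^ 2)).trace / (Fintype.card V - G.avgK3) *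
        (G.excessBound θ s t - G.avgK3) := by
  have := hG.connected.nonempty
  have h1 := sub_pos.2 (G.avgK3_lt)
  have h2 := hG.trace_sq_pos (sub_C_ne_zero hs t) (by rw [natDegree_sub_C]; omega)
  rw [hG.sum_near_sub_sq (by rw [natDegree_sub_C]; omega), hG.excessBound_eq]
  field_simp
  ring

/-- Since `t` is arbitrary, a vanishing denominator in `tau` does no harm. -/
theorem avgK3_le_excessBound (hG : G.HasFourEigenvalues k θ) {s : ℝ[X]} (hs : s.natDegree = 2)
    (t : ℝ) : G.avgK3 ≤ G.excessBound θ s t := by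
  have := hG.connected.nonempty
  have h1 := sub_pos.2 (G.avgK3_lt)
  have h2 := hG.trace_sq_pos (sub_C_ne_zero hs t) (by rw [natDegree_sub_C]; omega)
  have h := hG.sum_near_sub_mean_sq hs t
  have h0 : 0 ≤ (∑ u, ∑ v, if G.dist u v ≤ 2 then (aeval (G.adjMatrix ℝ) (s - C t) u v -
        (s - C t).eval (θ 0) / (Fintype.card V - G.avgK3)) ^ 2 else 0) :=
    Finset.sum_nonneg fun u _ => Finset.sum_nonneg fun v _ => by positivity
  rw [h] at h0
  exact sub_nonneg.1 (nonneg_of_mul_nonneg_right h0 (by positivity))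

theorem avgK3_eq_excessBound_iff (hG : G.HasFourEigenvalues k θ) {s : ℝ[X]}
    (hs : s.natDegree = 2) (t : ℝ) : G.avgK3 = G.excessBound θ s t ↔
      ∀ u v, G.dist u v ≤ 2 → aeval (G.adjMatrix ℝ) (s - C t) u v =
        (s - C t).eval (θ 0) / (Fintype.card V - G.avgK3) := by
  have := hG.connected.nonempty
  have h1 := sub_pos.2 (G.avgK3_lt)
  have h2 := hG.trace_sq_pos (sub_C_ne_zero hs t) (by rw [natDegree_sub_C]; omega)
  have h := hG.sum_near_sub_mean_sq hs t
  have h3 : (G.avgK3 = G.excessBound θ s t) ↔ (aeval (G.adjMatrix ℝ) ((s - C t) ^ 2)).trace /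
      (Fintype.card V - G.avgK3) * (G.excessBound θ s t - G.avgK3) = 0 := by
    rw [mul_eq_zero, or_iff_right (by positivity), sub_eq_zero, eq_comm]
  rw [h3, ← h, Finset.sum_eq_zero_iff_of_nonneg
    fun u _ => Finset.sum_nonneg fun v _ => by positivity]
  refine forall_congr' fun u => ?_
  rw [Finset.sum_eq_zero_iff_of_nonneg fun v _ => by positivity]
  simp [sub_eq_zero]

/-- Completing the sums by their term at `θ 0`, of multiplicity one, leaves numerator and
denominator unchanged. -/
theorem tau_eq (hG : G.HasFourEigenvalues k θ) (s : ℝ[X]) :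
    G.tau θ s = (s.eval (θ 0) * (aeval (G.adjMatrix ℝ) s).trace -
        (aeval (G.adjMatrix ℝ) (s ^ 2)).trace) /
      (s.eval (θ 0) * Fintype.card V - (aeval (G.adjMatrix ℝ) s).trace) := by
  have h := hG.sum_succ (s ^ 2)
  simp only [eval_pow] at h
  rw [tau, hG.sum_succ, h]
  congr 1 <;> ring

end HasFourEigenvalues

end SimpleGraph

/-! ### Distance matrices and the relation `A² = kI + aA + cA₂` -/

namespace SimpleGraph

open scoped Matrix

section

variable {V : Type*} {G : SimpleGraph V}

/-- The `0/1` matrix of the relation "at distance `i`". -/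
noncomputable def distMatrix (G : SimpleGraph V) (i : ℕ) : Matrix V V ℝ :=
  Matrix.of fun u v => if G.dist u v = i then 1 else 0

theorem distMatrix_apply (i : ℕ) (u v : V) :
    G.distMatrix i u v = if G.dist u v = i then 1 else 0 := rfl

/-- The entries of the matrix depend only on the distance in `G`. -/
def DependsOnDist (G : SimpleGraph V) (M : Matrix V V ℝ) : Prop :=
  ∃ f : ℕ → ℝ, ∀ u v, M u v = f (G.dist u v)

namespace DependsOnDist

theorem add {M N : Matrix V V ℝ} (hM : G.DependsOnDist M) (hN : G.DependsOnDist N) :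
    G.DependsOnDist (M + N) := by
  obtain ⟨f, hf⟩ := hM
  obtain ⟨g, hg⟩ := hN
  exact ⟨fun i => f i + g i, fun u v => by simp [hf, hg]⟩

theorem smul {M : Matrix V V ℝ} (hM : G.DependsOnDist M) (c : ℝ) : G.DependsOnDist (c • M) := by
  obtain ⟨f, hf⟩ := hM
  exact ⟨fun i => c * f i, fun u v => by simp [hf]⟩

theorem sub {M N : Matrix V V ℝ} (hM : G.DependsOnDist M) (hN : G.DependsOnDist N) :
    G.DependsOnDist (M - N) := by
  rw [sub_eq_add_neg, ← neg_one_smul ℝ]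
  exact hM.add (hN.smul _)

theorem distMatrix (i : ℕ) : G.DependsOnDist (G.distMatrix i) :=
  ⟨fun j => if j = i then 1 else 0, fun _ _ => rfl⟩

theorem const (c : ℝ) : G.DependsOnDist (Matrix.of fun _ _ => c) := ⟨fun _ => c, fun _ _ => rfl⟩

end DependsOnDist

theorem distMatrix_zero [DecidableEq V] (hconn : G.Connected) : G.distMatrix 0 = 1 := by
  ext u v
  simp [distMatrix_apply, hconn.dist_eq_zero_iff, Matrix.one_apply]

theorem distMatrix_one [DecidableRel G.Adj] : G.distMatrix 1 = G.adjMatrix ℝ := by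
  ext u v
  simp [distMatrix_apply, dist_eq_one_iff_adj]

theorem adjMatrix_distanceGraph [DecidableEq V] {i : ℕ} (hi : i ≠ 0) :
    (G.distanceGraph i).adjMatrix ℝ = G.distMatrix i := by
  ext u v
  have : (G.distanceGraph i).Adj u v ↔ G.dist u v = i := by
    refine ⟨fun h => h.2, fun h => ⟨?_, h⟩⟩
    rintro rfl
    simp at h
    exact hi h.symm
  simp [distMatrix_apply, adjMatrix_apply, this]

variable [Fintype V]

theorem distMatrix_mul_adjMatrix_apply [DecidableRel G.Adj] (i : ℕ) (u v : V) :
    (G.distMatrix i * G.adjMatrix ℝ) u v = ({w | G.Adj v w ∧ G.dist u w = i}.ncard : ℝ) := by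
  rw [mul_adjMatrix_apply, Set.ncard_eq_toFinset_card']
  simp only [distMatrix_apply, Finset.sum_boole]
  congr 2
  ext w
  simp

theorem trace_distMatrix_mul {i j : ℕ} (hij : i ≠ j) :
    (G.distMatrix i * G.distMatrix j).trace = 0 := by
  refine Finset.sum_eq_zero fun u _ => Finset.sum_eq_zero fun v _ => ?_
  simp only [distMatrix_apply, G.dist_comm (u := v)]
  split_ifs <;> simp
  omega

theorem trace_distMatrix_mul_self (i : ℕ) :
    (G.distMatrix i * G.distMatrix i).trace = ∑ u, ∑ v, G.distMatrix i u v := by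
  refine Finset.sum_congr rfl fun u _ => Finset.sum_congr rfl fun v _ => ?_
  simp only [distMatrix_apply, G.dist_comm (u := v)]
  split_ifs <;> simp

theorem adjMatrix_mul_self_apply [DecidableRel G.Adj] (u v : V) : (G.adjMatrix ℝ * G.adjMatrix ℝ) u v =
    (Fintype.card (G.commonNeighbors u v) : ℝ) := by
  rw [← Set.toFinset_card, mul_adjMatrix_apply]
  simp only [adjMatrix_apply, Finset.sum_boole]
  congr 2
  ext w
  simp [mem_commonNeighbors, and_comm]

/-- The entries of `AᵢA` count the neighbours of `v` at distance `i` from `u`; floors turn the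
real-valued functions into natural numbers. -/
theorem isDistanceRegular_of_dependsOnDist [DecidableRel G.Adj] (hconn : G.Connected)
    (h : ∀ i, G.DependsOnDist (G.distMatrix i * G.adjMatrix ℝ)) : G.IsDistanceRegular := by
  choose f hf using h
  refine ⟨hconn, fun i => ⌊f (i + 1) i⌋₊, fun i => if i = 0 then 0 else ⌊f (i - 1) i⌋₊,
    fun u v => ⟨?_, ?_⟩⟩
  · dsimp only
    split_ifs with h0
    · simp [h0]
    · rw [← hf, distMatrix_mul_adjMatrix_apply, Nat.floor_natCast]
      congr 1
      ext w
      simp only [Set.mem_ofPred_eq]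
      exact and_congr_right fun _ => by omega
  · dsimp only
    rw [← hf, distMatrix_mul_adjMatrix_apply, Nat.floor_natCast]

theorem trace_distMatrix [DecidableEq V] {i : ℕ} (hi : i ≠ 0) : (G.distMatrix i).trace = 0 := by
  rw [← adjMatrix_distanceGraph hi, trace_adjMatrix]

theorem trace_adjMatrix_mul_distMatrix_two [DecidableRel G.Adj] :
    (G.adjMatrix ℝ * G.distMatrix 2).trace = 0 := by
  rw [← distMatrix_one, trace_distMatrix_mul (by norm_num)]

end

variable {V : Type*} [Fintype V] [DecidableEq V] {G : SimpleGraph V} [DecidableRel G.Adj]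

/-- A graph whose adjacency matrix satisfies a suitable quadratic equation is strongly regular. -/
theorem exists_isSRGWith_of_mul_self {x y z : ℝ}
    (h : ∀ u v, (G.adjMatrix ℝ * G.adjMatrix ℝ) u v =
      x * (1 : Matrix V V ℝ) u v + y * G.adjMatrix ℝ u v + z) :
    ∃ k l m : ℕ, G.IsSRGWith (Fintype.card V) k l m := by
  refine ⟨⌊x + z⌋₊, ⌊y + z⌋₊, ⌊z⌋₊, rfl, fun v => ?_, fun v w hvw => ?_, fun v w hne hvw => ?_⟩
  · have := h v v
    rw [adjMatrix_mul_self_apply_self] at this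
    simp only [Matrix.one_apply_eq, adjMatrix_apply, G.irrefl, if_false] at this
    rw [← Nat.floor_natCast (R := ℝ) (G.degree v), this]
    congr 1
    ring
  · have := h v w
    rw [adjMatrix_mul_self_apply, Matrix.one_apply_ne hvw.ne, adjMatrix_apply, if_pos hvw] at this
    rw [← Nat.floor_natCast (R := ℝ) (Fintype.card _), this]
    congr 1
    ring
  · have := h v w
    rw [adjMatrix_mul_self_apply, Matrix.one_apply_ne hne, adjMatrix_apply, if_neg hvw] at this
    rw [← Nat.floor_natCast (R := ℝ) (Fintype.card _), this]
    congr 1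
    ring

namespace HasFourEigenvalues

variable {k : ℕ} {θ : Fin 4 → ℝ}

theorem sum_distMatrix (hG : G.HasFourEigenvalues k θ) :
    1 + G.adjMatrix ℝ + G.distMatrix 2 + G.distMatrix 3 = Matrix.of fun _ _ => (1 : ℝ) := by
  ext u v
  have := hG.dist_le u v
  rw [← distMatrix_zero hG.connected, ← distMatrix_one]
  simp only [Matrix.add_apply, distMatrix_apply, Matrix.of_apply]
  interval_cases G.dist u v <;> simp

/-- The relation expresses `A₂A` through `A³`, `A²` and `A`; summing all distance matrices to `J`
then yields `A₃A`. -/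
theorem isDistanceRegular (hG : G.HasFourEigenvalues k θ) {a c : ℝ} (hc : c ≠ 0)
    (h : G.adjMatrix ℝ * G.adjMatrix ℝ =
      (k : ℝ) • (1 : Matrix V V ℝ) + a • G.adjMatrix ℝ + c • G.distMatrix 2) :
    G.IsDistanceRegular := by
  set A := G.adjMatrix ℝ with hA
  have d0 : G.DependsOnDist 1 := distMatrix_zero hG.connected ▸ DependsOnDist.distMatrix 0
  have d1 : G.DependsOnDist A := hA ▸ distMatrix_one (G := G) ▸ DependsOnDist.distMatrix 1
  have dAA : G.DependsOnDist (A * A) :=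
    h ▸ ((d0.smul _).add (d1.smul _)).add ((DependsOnDist.distMatrix 2).smul _)
  have dAAA : G.DependsOnDist (A * A * A) := by
    -- This product is a multiple of `J`, which reduces `A³` to lower powers.
    obtain ⟨t, ht⟩ : ∃ t : ℝ, aeval A ((X - C (θ 1)) * (X - C (θ 2)) * (X - C (θ 3))) =
        Matrix.of fun _ _ => t := by
      refine ⟨_, Matrix.ext fun u v => aeval_adjMatrix_const hG.connected hG.regular _ ?_ u v⟩
      rw [hG.spectrum_eq, ← hG.zero_eq]
      rintro _ ⟨i, rfl⟩ hi
      fin_cases i <;> simp at hi ⊢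
    have hexp : A * A * A = (θ 1 + θ 2 + θ 3) • (A * A) -
        (θ 1 * θ 2 + θ 1 * θ 3 + θ 2 * θ 3) • A + (θ 1 * θ 2 * θ 3) • (1 : Matrix V V ℝ) +
        Matrix.of fun _ _ => t := by
      rw [← ht]
      simp only [map_mul, map_sub, aeval_X, aeval_C, Algebra.algebraMap_eq_smul_one, sub_mul,
        mul_sub, smul_mul_assoc, mul_smul_comm, one_mul, mul_one]
      module
    rw [hexp]
    exact (((dAA.smul _).sub (d1.smul _)).add (d0.smul _)).add (DependsOnDist.const t)
  have d2 : G.DependsOnDist (G.distMatrix 2 * A) := by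
    have : G.distMatrix 2 * A = c⁻¹ • (A * A * A - (k : ℝ) • A - a • (A * A)) := by
      conv_rhs => rw [h]
      simp only [add_mul, smul_mul_assoc, one_mul]
      rw [h]
      match_scalars <;> field_simp <;> ring
    rw [this]
    exact ((dAAA.sub (d1.smul _)).sub (dAA.smul _)).smul _
  refine isDistanceRegular_of_dependsOnDist hG.connected fun i => ?_
  match i with
  | 0 => rwa [distMatrix_zero hG.connected, one_mul]
  | 1 => rwa [distMatrix_one]
  | 2 => exact d2
  | 3 =>
    have : G.distMatrix 3 * A = (Matrix.of fun _ _ => (k : ℝ)) - A - A * A - G.distMatrix 2 * A := by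
      have hJ : (Matrix.of fun _ _ => (1 : ℝ)) * A = Matrix.of fun _ _ : V => (k : ℝ) := by
        ext u v
        simp [hA, mul_adjMatrix_apply, hG.regular.degree_eq v]
      rw [← hJ, ← hG.sum_distMatrix]
      simp only [add_mul, one_mul]
      abel
    rw [this]
    exact (((DependsOnDist.const _).sub d1).sub dAA).sub d2
  | i + 4 =>
    have : G.distMatrix (i + 4) = 0 := by
      ext u v
      have := hG.dist_le u v
      simp [distMatrix_apply]
      omega
    rw [this, zero_mul]
    exact ⟨fun _ => 0, fun _ _ => rfl⟩

theorem distMatrix_two_eq_aeval {a c : ℝ} (hc : c ≠ 0)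
    (h : G.adjMatrix ℝ * G.adjMatrix ℝ =
      (k : ℝ) • (1 : Matrix V V ℝ) + a • G.adjMatrix ℝ + c • G.distMatrix 2) :
    G.distMatrix 2 = aeval (G.adjMatrix ℝ) (C c⁻¹ * (X ^ 2 - C a * X - C (k : ℝ))) := by
  simp only [map_mul, map_sub, aeval_X, aeval_C, pow_two, h,
    Algebra.algebraMap_eq_smul_one, smul_mul_assoc, one_mul]
  match_scalars <;> field_simp <;> ring

/-- Two vertices at distance 2 have `c` common neighbours. In particular `c` is invertible. -/
theorem one_le_of_mul_self (hG : G.HasFourEigenvalues k θ) {a c : ℝ}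
    (h : G.adjMatrix ℝ * G.adjMatrix ℝ =
      (k : ℝ) • (1 : Matrix V V ℝ) + a • G.adjMatrix ℝ + c • G.distMatrix 2) : 1 ≤ c := by
  obtain ⟨u, v, huv⟩ := exists_dist_eq_two_of_spectrum hG.connected hG.strictAnti hG.spectrum_eq
  have h1 := one_le_adjMatrix_sq hG.connected huv
  rw [h, ← distMatrix_zero hG.connected, ← distMatrix_one] at h1
  simpa [distMatrix_apply, huv] using h1

theorem avgCircuits_eq (hG : G.HasFourEigenvalues k θ) (l : ℕ) :
    G.avgCircuits θ l = (G.adjMatrix ℝ ^ l).trace / Fintype.card V := by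
  have := hG.trace_aeval (X ^ l)
  simp only [map_pow, aeval_X, eval_pow, eval_X] at this
  rw [avgCircuits, this]

theorem trace_mul_self (hG : G.HasFourEigenvalues k θ) :
    (G.adjMatrix ℝ * G.adjMatrix ℝ).trace = k * Fintype.card V := by
  simp only [Matrix.trace, Matrix.diag_apply, adjMatrix_mul_self_apply_self, hG.regular.degree_eq]
  simp [mul_comm]

theorem trace_pow_three (hG : G.HasFourEigenvalues k θ) {a c : ℝ}
    (h : G.adjMatrix ℝ * G.adjMatrix ℝ =
      (k : ℝ) • (1 : Matrix V V ℝ) + a • G.adjMatrix ℝ + c • G.distMatrix 2) :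
    (G.adjMatrix ℝ ^ 3).trace = a * k * Fintype.card V := by
  rw [pow_succ', pow_two]
  conv_lhs => rw [h]
  simp [mul_add, hG.trace_mul_self, trace_adjMatrix_mul_distMatrix_two]
  ring

/-- With `S` the number of ordered pairs at distance 2, the relation gives `tr A³ = akn` and `tr A⁴
= k²n + a²kn + c²S`, and row sums give `k²n = kn + akn + cS`. The quotient then reduces to
`(-c²kS/n) / (-ckS/n)`. -/
theorem preintersection2_eq (hG : G.HasFourEigenvalues k θ) {a c : ℝ}
    (h : G.adjMatrix ℝ * G.adjMatrix ℝ =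
      (k : ℝ) • (1 : Matrix V V ℝ) + a • G.adjMatrix ℝ + c • G.distMatrix 2) :
    G.preintersection2 k θ = c := by
  have hc := hG.one_le_of_mul_self h
  obtain ⟨u₀, v₀, huv⟩ := exists_dist_eq_two_of_spectrum hG.connected hG.strictAnti hG.spectrum_eq
  have := hG.connected.nonempty
  set S := ∑ u, ∑ v, G.distMatrix 2 u v with hS
  have hnn : ∀ u v, 0 ≤ G.distMatrix 2 u v := fun u v => by
    rw [distMatrix_apply]
    positivity
  have hSpos : 0 < S := by
    refine Finset.sum_pos' (fun u _ => Finset.sum_nonneg fun v _ => hnn u v)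
      ⟨u₀, Finset.mem_univ _, Finset.sum_pos' (fun v _ => hnn _ v) ⟨v₀, Finset.mem_univ _, ?_⟩⟩
    simp [distMatrix_apply, huv]
  have hrow : (k : ℝ) ^ 2 * Fintype.card V = k * Fintype.card V + a * k * Fintype.card V + c * S := by
    have h1 : ∀ u, (k : ℝ) ^ 2 = k + a * k + c * ∑ v, G.distMatrix 2 u v := fun u => by
      have h2 := aeval_adjMatrix_row_sum hG.regular (X ^ 2) u
      have h3 := aeval_adjMatrix_row_sum hG.regular X u
      simp only [pow_two, map_mul, eval_mul, aeval_X, eval_X, h, Matrix.add_apply,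
        Matrix.smul_apply, smul_eq_mul, Finset.sum_add_distrib, ← Finset.mul_sum] at h2 h3
      rw [h3] at h2
      simp only [Matrix.one_apply, Finset.sum_ite_eq, Finset.mem_univ, if_true, mul_one] at h2
      linarith
    have h4 := Finset.sum_congr rfl fun u (_ : u ∈ Finset.univ) => h1 u
    simp only [Finset.sum_add_distrib, ← Finset.mul_sum, Finset.sum_const, nsmul_eq_mul,
      Finset.card_univ] at h4
    rw [← hS] at h4
    linarith
  have t2 := hG.trace_mul_self
  have t3 := hG.trace_pow_three h
  have t12 := trace_adjMatrix_mul_distMatrix_two (G := G)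
  have t4 : (G.adjMatrix ℝ ^ 4).trace = k ^ 2 * Fintype.card V + a ^ 2 * k * Fintype.card V +
      c ^ 2 * S := by
    have : G.adjMatrix ℝ ^ 4 = (G.adjMatrix ℝ * G.adjMatrix ℝ) * (G.adjMatrix ℝ * G.adjMatrix ℝ) := by
      noncomm_ring
    rw [this]
    conv_lhs => rw [h]
    simp [mul_add, add_mul, t2, t12, Matrix.trace_mul_comm _ (G.adjMatrix ℝ), trace_distMatrix,
      trace_distMatrix_mul_self]
    rw [← hS]
    ring
  have hn : (Fintype.card V : ℝ) ≠ 0 := by positivity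
  have hk : (k : ℝ) ≠ 0 := by
    intro hk
    rw [hk] at hrow
    have : 0 < c * S := by positivity
    linarith
  rw [preintersection2, hG.avgCircuits_eq, hG.avgCircuits_eq, t3, t4]
  have hden : (k : ℝ) * (a * k * Fintype.card V / Fintype.card V + k - k ^ 2) =
      -(k * (c * S)) / Fintype.card V := by
    field_simp
    linarith
  rw [hden, div_eq_iff (div_ne_zero (neg_ne_zero.2 (by positivity)) hn)]
  field_simp
  ring

end HasFourEigenvalues

theorem IsSRGWith.exists_mul_self {n k l m : ℕ} (h : G.IsSRGWith n k l m) :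
    ∃ x y z : ℝ, ∀ u v, (G.adjMatrix ℝ * G.adjMatrix ℝ) u v =
      x * (1 : Matrix V V ℝ) u v + y * G.adjMatrix ℝ u v + z := by
  refine ⟨k - m, l - m, m, fun u v => ?_⟩
  rcases eq_or_ne u v with rfl | huv
  · rw [adjMatrix_mul_self_apply_self, h.regular.degree_eq]
    simp
  · rw [adjMatrix_mul_self_apply, Matrix.one_apply_ne huv, adjMatrix_apply]
    split_ifs with hadj
    · rw [h.of_adj u v hadj]
      ring
    · rw [h.of_not_adj huv hadj]
      ring

theorem exists_adj_of_dist_ne_zero {V : Type*} {G : SimpleGraph V} (hconn : G.Connected) {u v : V}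
    (h : G.dist u v ≠ 0) : ∃ w, G.Adj u w := by
  obtain ⟨q, hq⟩ := hconn.exists_walk_length_eq_dist u v
  cases q with
  | nil => exact (h hq.symm).elim
  | cons hadj _ => exact ⟨_, hadj⟩

theorem aeval_quadratic_apply (b d t : ℝ) (u v : V) :
    aeval (G.adjMatrix ℝ) (X ^ 2 - C b * X + C d - C t) u v =
      (G.adjMatrix ℝ * G.adjMatrix ℝ) u v - b * G.adjMatrix ℝ u v +
        (d - t) * (1 : Matrix V V ℝ) u v := by
  simp only [map_sub, map_add, map_mul, aeval_X, aeval_C, pow_two,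
    Algebra.algebraMap_eq_smul_one, smul_mul_assoc, one_mul, Matrix.add_apply, Matrix.sub_apply,
    Matrix.smul_apply, smul_eq_mul]
  ring

theorem natDegree_quadratic (b d : ℝ) : (X ^ 2 - C b * X + C d : ℝ[X]).natDegree = 2 := by
  compute_degree!

/-! ### Consequences of equality -/

namespace HasFourEigenvalues

variable {k : ℕ} {θ : Fin 4 → ℝ}

theorem exists_adj (hG : G.HasFourEigenvalues k θ) (u : V) : ∃ v, G.Adj u v := by
  obtain ⟨x, y, hxy⟩ := exists_dist_eq_two_of_spectrum hG.connected hG.strictAnti hG.spectrum_eq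
  have h := exists_adj_of_dist_ne_zero hG.connected (u := x) (v := y) (by omega)
  rw [← degree_pos_iff_exists_adj, hG.regular.degree_eq] at h ⊢
  exact h

/-- Since `J(A - k) = 0`, the polynomial `p · (X - k)` annihilates `A`, hence vanishes on the
spectrum. -/
theorem eval_eq_zero_of_aeval_const (hG : G.HasFourEigenvalues k θ) {p : ℝ[X]} {z : ℝ}
    (hp : ∀ u v, aeval (G.adjMatrix ℝ) p u v = z) {i : Fin 4} (hi : i ≠ 0) :
    p.eval (θ i) = 0 := by
  have h0 : aeval (G.adjMatrix ℝ) (p * (X - C (k : ℝ))) = 0 := by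
    ext u v
    simp only [map_mul, map_sub, aeval_X, aeval_C, mul_sub, Algebra.algebraMap_eq_smul_one,
      mul_smul_comm, mul_one, Matrix.sub_apply, Matrix.smul_apply, mul_adjMatrix_apply, hp]
    simp [hG.regular.degree_eq]
  have hs := (isHermitian_adjMatrix (R := ℝ) (G := G)).spectrum_aeval (p * (X - C (k : ℝ)))
  have := hG.connected.nonempty
  rw [h0, spectrum.zero_eq, hG.spectrum_eq] at hs
  have : (p * (X - C (k : ℝ))).eval (θ i) ∈ ({0} : Set ℝ) := hs ▸ ⟨θ i, ⟨i, rfl⟩, rfl⟩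
  have h1 : p.eval (θ i) * (θ i - k) = 0 := by simpa using this
  refine (mul_eq_zero.1 h1).resolve_right (sub_ne_zero.2 ?_)
  rw [← hG.zero_eq]
  exact hG.strictAnti.injective.ne hi

/-- The polynomial `(p - x)(p - y)` vanishes at every eigenvalue other than `k`, so `(A₂ - x)(A₂ -
y)` is a multiple of `J`. -/
theorem isStronglyRegular_distanceGraph_two (hG : G.HasFourEigenvalues k θ) {p : ℝ[X]}
    (hp : G.distMatrix 2 = aeval (G.adjMatrix ℝ) p) {x y : ℝ}
    (h : ∀ z ∈ spectrum ℝ (G.adjMatrix ℝ), z ≠ k → p.eval z = x ∨ p.eval z = y) :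
    (G.distanceGraph 2).IsStronglyRegular := by
  obtain ⟨u, v, huv⟩ := exists_dist_eq_two_of_spectrum hG.connected hG.strictAnti hG.spectrum_eq
  obtain ⟨v', hadj⟩ := hG.exists_adj u
  refine ⟨fun hbot => ?_, fun htop => ?_, ?_⟩
  · have : (G.distanceGraph 2).Adj u v := ⟨by rintro rfl; simp at huv, huv⟩
    simp [hbot] at this
  · have : (G.distanceGraph 2).Adj u v' := htop ▸ hadj.ne
    have h1 := this.2
    rw [dist_eq_one_iff_adj.2 hadj] at h1
    norm_num at h1
  · refine exists_isSRGWith_of_mul_self (x := -(x * y)) (y := x + y) fun u v =>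
      sub_eq_iff_eq_add'.1 (Eq.trans ?_ (aeval_adjMatrix_const hG.connected hG.regular
        ((p - C x) * (p - C y)) (fun z hz hzk => ?_) u v))
    · rw [adjMatrix_distanceGraph two_ne_zero]
      simp only [map_mul, map_sub, ← hp, aeval_C, Algebra.algebraMap_eq_smul_one, sub_mul, mul_sub,
        smul_mul_assoc, mul_smul_comm, one_mul, mul_one, Matrix.sub_apply, Matrix.smul_apply,
        smul_eq_mul]
      ring
    · rcases h z hz hzk with h | h <;> simp [h]

/-- In the case of equality, the square of the adjacency matrix is a combination of the identity,
the adjacency matrix and the distance-2 matrix. -/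
theorem mul_self_of_avgK3_eq (hG : G.HasFourEigenvalues k θ) {b d t : ℝ}
    (h : G.avgK3 = G.excessBound θ (X ^ 2 - C b * X + C d) t) :
    ∃ c : ℝ, (k : ℝ) = c - d + t ∧ (∀ u, (G.k3 u : ℝ) = G.avgK3) ∧
      G.adjMatrix ℝ * G.adjMatrix ℝ =
        (k : ℝ) • (1 : Matrix V V ℝ) + (c + b) • G.adjMatrix ℝ + c • G.distMatrix 2 := by
  rw [hG.avgK3_eq_excessBound_iff (natDegree_quadratic b d)] at h
  set c := (X ^ 2 - C b * X + C d - C t).eval (θ 0) / (Fintype.card V - G.avgK3) with hc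
  have := hG.connected.nonempty
  obtain ⟨v₀⟩ := hG.connected.nonempty
  have hk : (k : ℝ) = c - d + t := by
    have := h v₀ v₀ (by simp)
    rw [aeval_quadratic_apply, adjMatrix_mul_self_apply_self, hG.regular.degree_eq] at this
    simp at this
    linarith
  have hrel : G.adjMatrix ℝ * G.adjMatrix ℝ =
        (k : ℝ) • (1 : Matrix V V ℝ) + (c + b) • G.adjMatrix ℝ + c • G.distMatrix 2 := by
    ext u v
    have h1 : G.dist u v ≤ 2 → _ := h u v
    have h2 := aeval_adjMatrix_eq_zero_of_lt_dist (G := G) (X ^ 2 - C b * X + C d - C t) (u := u) (v := v)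
    rw [natDegree_sub_C, natDegree_quadratic] at h2
    rw [aeval_quadratic_apply, ← distMatrix_zero hG.connected, ← distMatrix_one (G := G)] at h1 h2
    rw [← distMatrix_zero hG.connected, ← distMatrix_one (G := G)]
    simp only [Matrix.add_apply, Matrix.smul_apply, smul_eq_mul, distMatrix_apply] at h1 h2 ⊢
    have := hG.dist_le u v
    generalize G.dist u v = j at *
    interval_cases j <;> norm_num at h1 h2 ⊢ <;> linarith
  refine ⟨c, hk, fun u => ?_, hrel⟩
  have hc0 : c ≠ 0 := by linarith [hG.one_le_of_mul_self hrel]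
  -- The row sum is the same at every vertex and equals `c` times the number of vertices within
  -- distance 2, so `k3` is constant.
  have h1 := aeval_adjMatrix_row_sum hG.regular (X ^ 2 - C b * X + C d - C t) u
  have h2 : ∀ v, aeval (G.adjMatrix ℝ) (X ^ 2 - C b * X + C d - C t) u v =
      c * if G.dist u v ≤ 2 then (1 : ℝ) else 0 := fun v => by
    split_ifs with h3
    · rw [h u v h3, mul_one]
    · rw [mul_zero]
      refine aeval_adjMatrix_eq_zero_of_lt_dist _ ?_
      rw [natDegree_sub_C, natDegree_quadratic]
      omega
  simp only [h2, ← Finset.mul_sum, sum_dist_le_two hG.dist_le] at h1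
  have h3 := sub_pos.2 G.avgK3_lt
  rw [← hG.zero_eq, ← div_mul_cancel₀ (eval (θ 0) _) h3.ne', ← hc] at h1
  linarith [mul_left_cancel₀ hc0 h1]

/-- Stated for `α, β, γ` so as to serve both `s₁` (`γ = θ 2`) and `s₂` (`γ = θ 3`). As `c = γ₂`, the
coefficient of `A` in `A²` becomes `α + β`, which makes `P` agree at `α` and `β`. -/
theorem consequences_of_avgK3_eq (hG : G.HasFourEigenvalues k θ) {α β γ t : ℝ}
    (hθ : Set.range θ = {θ 0, α, β, γ})
    (h : G.avgK3 = G.excessBound θ (X ^ 2 - C (α + β - G.preintersection2 k θ) * X +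
      C (G.preintersection2 k θ + γ * (α - γ + β))) t) :
    (∀ u, (G.k3 u : ℝ) = G.avgK3) ∧
    spectrum ℝ ((G.distanceGraph 2).adjMatrix ℝ) =
      {Fintype.card V - G.avgK3 - θ 0 - 1,
        ((α - γ) * (γ - β) - t) / G.preintersection2 k θ, -t / G.preintersection2 k θ} ∧
    G.IsDistanceRegular ∧ (G.distanceGraph 2).IsStronglyRegular := by
  obtain ⟨c, hk, hk3, hrel⟩ := hG.mul_self_of_avgK3_eq h
  rw [hG.preintersection2_eq hrel] at hk hrel ⊢
  rw [add_sub_cancel] at hrel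
  have hc0 : c ≠ 0 := by linarith [hG.one_le_of_mul_self hrel]
  have hP := distMatrix_two_eq_aeval hc0 hrel
  set P := C c⁻¹ * (X ^ 2 - C (α + β) * X - C (k : ℝ)) with hPdef
  have hα : P.eval α = ((α - γ) * (γ - β) - t) / c := by
    simp only [hPdef, eval_mul, eval_sub, eval_pow, eval_X, eval_C, hk]
    field_simp
    ring
  have hβ : P.eval β = ((α - γ) * (γ - β) - t) / c := by
    simp only [hPdef, eval_mul, eval_sub, eval_pow, eval_X, eval_C, hk]
    field_simp
    ring
  have hγ : P.eval γ = -t / c := by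
    simp only [hPdef, eval_mul, eval_sub, eval_pow, eval_X, eval_C, hk]
    field_simp
    ring
  have h0 : P.eval (θ 0) = Fintype.card V - G.avgK3 - θ 0 - 1 := by
    obtain ⟨u⟩ := hG.connected.nonempty
    have h1 := aeval_adjMatrix_row_sum hG.regular P u
    have h2 := aeval_adjMatrix_row_sum hG.regular X u
    have h3 := sum_dist_le_two hG.dist_le u
    have h4 : ∀ v, (if G.dist u v ≤ 2 then (1 : ℝ) else 0) =
        (1 : Matrix V V ℝ) u v + G.adjMatrix ℝ u v + G.distMatrix 2 u v := fun v => by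
      rw [← distMatrix_zero hG.connected, ← distMatrix_one]
      simp only [distMatrix_apply]
      have := hG.dist_le u v
      generalize G.dist u v = j at *
      interval_cases j <;> simp
    simp only [h4, Finset.sum_add_distrib, Matrix.one_apply, Finset.sum_ite_eq, Finset.mem_univ,
      if_true] at h3
    rw [← hP] at h1
    rw [aeval_X, eval_X] at h2
    rw [h1, h2, hk3, ← hG.zero_eq] at h3
    linarith
  refine ⟨hk3, ?_, hG.isDistanceRegular hc0 hrel,
    hG.isStronglyRegular_distanceGraph_two hP (x := ((α - γ) * (γ - β) - t) / c)
      (y := -t / c) fun z hz hzk => ?_⟩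
  · rw [adjMatrix_distanceGraph two_ne_zero, hP,
      (isHermitian_adjMatrix (R := ℝ) (G := G)).spectrum_aeval, hG.spectrum_eq, hθ]
    simp only [Set.image_insert_eq, Set.image_singleton, h0, hα, hβ, hγ, Set.insert_idem]
  · rw [hG.spectrum_eq, hθ, hG.zero_eq] at hz
    rcases hz with rfl | rfl | rfl | rfl
    · exact (hzk rfl).elim
    · exact Or.inl hα
    · exact Or.inl hβ
    · exact Or.inr hγ

/-! ### The converse: from regularity to equality -/

theorem exists_mul_self_of_isDistanceRegular (hG : G.HasFourEigenvalues k θ)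
    (h : G.IsDistanceRegular) : ∃ a c : ℝ, 0 ≤ a ∧ G.adjMatrix ℝ * G.adjMatrix ℝ =
      (k : ℝ) • (1 : Matrix V V ℝ) + a • G.adjMatrix ℝ + c • G.distMatrix 2 := by
  obtain ⟨-, b, c, hbc⟩ := h
  have hrel : G.adjMatrix ℝ * G.adjMatrix ℝ = (k : ℝ) • (1 : Matrix V V ℝ) +
      ((k : ℝ) - 1 - b 1) • G.adjMatrix ℝ + (c 2 : ℝ) • G.distMatrix 2 := by
    ext u v
    rw [← distMatrix_zero hG.connected]
    conv_rhs => rw [← distMatrix_one (G := G)]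
    simp only [Matrix.add_apply, Matrix.smul_apply, smul_eq_mul, distMatrix_apply]
    obtain ⟨hc, hb⟩ := hbc u v
    have hle := hG.dist_le u v
    rcases Nat.lt_or_ge 2 (G.dist u v) with h3 | h3
    · have h1 := aeval_adjMatrix_eq_zero_of_lt_dist (G := G) (X ^ 2 : ℝ[X]) (u := u) (v := v)
        (by simpa using h3)
      rw [map_pow, aeval_X, pow_two] at h1
      rw [h1, if_neg (by omega), if_neg (by omega), if_neg (by omega)]
      ring
    · have hd : (G.distMatrix 1 * G.adjMatrix ℝ) u v = _ := distMatrix_mul_adjMatrix_apply 1 u v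
      rw [distMatrix_one] at hd
      interval_cases hj : G.dist u v
      · obtain rfl := hG.connected.dist_eq_zero_iff.1 hj
        rw [adjMatrix_mul_self_apply_self, hG.regular.degree_eq]
        simp
      -- For adjacent `u`, `v`, sort the `k` neighbours of `v` by distance from `u`: one at distance
      -- 0, `b 1` at distance 2, none at distance 3.
      · have hJ := congrArg (fun M => (M * G.adjMatrix ℝ) u v) hG.sum_distMatrix
        simp only [add_mul, one_mul, Matrix.add_apply, distMatrix_mul_adjMatrix_apply] at hJ
        have h3 : {w | G.Adj v w ∧ G.dist u w = 3} = ∅ := by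
          ext w
          simp only [Set.mem_ofPred_eq, Set.mem_empty_iff_false, iff_false, not_and]
          intro hw h3
          have := hG.connected.dist_triangle (u := u) (v := v) (w := w)
          rw [hj, dist_eq_one_iff_adj.2 hw] at this
          omega
        rw [h3, hb] at hJ
        simp only [mul_adjMatrix_apply (G := G) (M := Matrix.of fun _ _ => (1 : ℝ)), adjMatrix_apply,
          if_pos (dist_eq_one_iff_adj.1 hj)] at hJ
        simp [hG.regular.degree_eq] at hJ
        simp
        linarith
      · rw [hd, ← hc]
        simp
  refine ⟨_, _, ?_, hrel⟩
  obtain ⟨u⟩ := hG.connected.nonempty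
  obtain ⟨v, huv⟩ := hG.exists_adj u
  have h1 := congrFun (congrFun hrel u) v
  rw [← distMatrix_zero hG.connected, adjMatrix_mul_self_apply] at h1
  simp [distMatrix_apply, dist_eq_one_iff_adj.2 huv, huv] at h1
  rw [← h1]
  positivity

/-- If `θ 2 + θ 3 = a`, then `(A - θ 2)(A - θ 3)A` has trace `akn - a·kn = 0`. In the spectral sum
the terms at `θ 2` and `θ 3` vanish, the one at `θ 0` is positive, and the one at `θ 1` is
nonnegative because `a ≥ 0` forces `θ 1 ≥ 0`. -/
theorem add_ne_of_mul_self (hG : G.HasFourEigenvalues k θ) {a c : ℝ} (ha : 0 ≤ a)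
    (h : G.adjMatrix ℝ * G.adjMatrix ℝ =
      (k : ℝ) • (1 : Matrix V V ℝ) + a • G.adjMatrix ℝ + c • G.distMatrix 2) :
    θ 2 + θ 3 ≠ a := by
  rintro rfl
  have h1 := hG.trace_aeval ((X - C (θ 2)) * (X - C (θ 3)) * X)
  have h2 : aeval (G.adjMatrix ℝ) ((X - C (θ 2)) * (X - C (θ 3)) * X) =
      G.adjMatrix ℝ ^ 3 - (θ 2 + θ 3) • (G.adjMatrix ℝ * G.adjMatrix ℝ) +
        (θ 2 * θ 3) • G.adjMatrix ℝ := by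
    simp only [map_mul, map_sub, aeval_X, aeval_C, Algebra.algebraMap_eq_smul_one, sub_mul,
      mul_sub, smul_mul_assoc, mul_smul_comm, one_mul, mul_one, pow_succ, pow_zero]
    module
  rw [h2, Matrix.trace_add, Matrix.trace_sub, Matrix.trace_smul, Matrix.trace_smul,
    hG.trace_pow_three h, hG.trace_mul_self, trace_adjMatrix, Fin.sum_univ_four,
    hG.eigMult_zero] at h1
  simp only [eval_mul, eval_sub, eval_X, eval_C, sub_self, smul_eq_mul] at h1
  have h01 := hG.strictAnti (show (0 : Fin 4) < 1 by decide)
  have h12 := hG.strictAnti (show (1 : Fin 4) < 2 by decide)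
  have h23 := hG.strictAnti (show (2 : Fin 4) < 3 by decide)
  have h1pos : 0 ≤ θ 1 := by linarith
  have p0 : 0 < (θ 0 - θ 2) * (θ 0 - θ 3) * θ 0 :=
    mul_pos (mul_pos (by linarith) (by linarith)) (by linarith)
  have p1 : 0 ≤ G.eigMult (θ 1) * ((θ 1 - θ 2) * (θ 1 - θ 3) * θ 1) :=
    mul_nonneg (by positivity) (mul_nonneg (mul_nonneg (by linarith) (by linarith)) h1pos)
  push_cast at h1
  linarith

/-- The constant term `d` is free because `tau` absorbs it: with `t = k + d - c` one has `(s - t)(A)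
= c(I + A + A₂)`, the equality criterion, and the traces of this matrix and its square show that
`tau` is this `t`. -/
theorem avgK3_eq_of_mul_self (hG : G.HasFourEigenvalues k θ) {a c : ℝ}
    (h : G.adjMatrix ℝ * G.adjMatrix ℝ =
      (k : ℝ) • (1 : Matrix V V ℝ) + a • G.adjMatrix ℝ + c • G.distMatrix 2) (d : ℝ) :
    G.avgK3 = G.excessBound θ (X ^ 2 - C (a - c) * X + C d)
      (G.tau θ (X ^ 2 - C (a - c) * X + C d)) := by
  have := hG.connected.nonempty
  have hc := hG.one_le_of_mul_self h
  set s : ℝ[X] := X ^ 2 - C (a - c) * X + C d with hs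
  set N : ℝ := Fintype.card V - G.avgK3 with hN
  have hNpos : 0 < N := sub_pos.2 G.avgK3_lt
  have hn : (0 : ℝ) < Fintype.card V := by positivity
  set t : ℝ := k + d - c with ht
  have hent : ∀ u v, aeval (G.adjMatrix ℝ) (s - C t) u v =
      c * if G.dist u v ≤ 2 then (1 : ℝ) else 0 := fun u v => by
    rw [hs, aeval_quadratic_apply, h, ← distMatrix_zero hG.connected, ← distMatrix_one]
    simp only [Matrix.add_apply, Matrix.smul_apply, smul_eq_mul, distMatrix_apply]
    have := hG.dist_le u v
    generalize G.dist u v = j at *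
    interval_cases j <;> norm_num
    linarith
  have hsum : (∑ u, ∑ v, aeval (G.adjMatrix ℝ) (s - C t) u v) = c * (Fintype.card V * N) := by
    simp only [hent, ← Finset.mul_sum, hG.sum_near, hN]
  have h0 : s.eval (θ 0) = t + c * N := by
    simp only [aeval_adjMatrix_row_sum hG.regular] at hsum
    rw [Finset.sum_const, Finset.card_univ, nsmul_eq_mul, mul_left_comm, ← hG.zero_eq, eval_sub,
      eval_C] at hsum
    linarith [mul_left_cancel₀ hn.ne' hsum]
  have hT1' : (aeval (G.adjMatrix ℝ) (s - C t)).trace = Fintype.card V * c := by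
    simp only [Matrix.trace, Matrix.diag_apply, hent]
    simp
  have hT1 : (aeval (G.adjMatrix ℝ) s).trace = Fintype.card V * (t + c) := by
    simp only [map_sub, aeval_C, Algebra.algebraMap_eq_smul_one, Matrix.trace_sub,
      Matrix.trace_smul, Matrix.trace_one, smul_eq_mul] at hT1'
    linarith
  have hT2' : (aeval (G.adjMatrix ℝ) ((s - C t) ^ 2)).trace = c ^ 2 * (Fintype.card V * N) := by
    rw [trace_aeval_adjMatrix_sq, hN, ← hG.sum_near]
    simp only [hent, mul_pow, ite_pow, one_pow, ne_eq, OfNat.ofNat_ne_zero, not_false_eq_true,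
      zero_pow, ← Finset.mul_sum]
  have hT2 : (aeval (G.adjMatrix ℝ) (s ^ 2)).trace =
      c ^ 2 * (Fintype.card V * N) + 2 * t * (Fintype.card V * c) + t ^ 2 * Fintype.card V := by
    have : s ^ 2 = (s - C t) ^ 2 + C (2 * t) * (s - C t) + C (t ^ 2) := by
      simp only [C_mul, C_pow, map_ofNat]
      ring
    rw [this, map_add, map_add, map_mul, aeval_C, aeval_C, Matrix.trace_add, Matrix.trace_add,
      hT2', Algebra.algebraMap_eq_smul_one, Algebra.algebraMap_eq_smul_one, smul_mul_assoc,
      one_mul, Matrix.trace_smul, Matrix.trace_smul, hT1', Matrix.trace_one]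
    simp
  -- The denominator of `tau` is `nc(N - 1)`; it is nonzero since every vertex has itself and a
  -- neighbour within distance 2.
  have hN1 : 1 < N := by
    have h2 : ∀ u, (1 : ℝ) < Fintype.card V - G.k3 u := fun u => by
      rw [← sum_dist_le_two hG.dist_le]
      obtain ⟨w, huw⟩ := hG.exists_adj u
      have h3 : ∑ v ∈ {u, w}, (if G.dist u v ≤ 2 then (1 : ℝ) else 0) = 2 := by
        rw [Finset.sum_pair huw.ne, dist_eq_one_iff_adj.2 huw]
        norm_num
      refine lt_of_lt_of_le one_lt_two (h3 ▸ Finset.sum_le_univ_sum_of_nonneg fun v => ?_)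
      positivity
    have h3 := Finset.sum_lt_sum_of_nonempty Finset.univ_nonempty fun u (_ : u ∈ Finset.univ) =>
      h2 u
    simp only [← sum_dist_le_two hG.dist_le, hG.sum_near] at h3
    simp only [Finset.sum_const, Finset.card_univ, nsmul_eq_mul, ← hN] at h3
    exact lt_of_mul_lt_mul_left h3 hn.le
  have htau : G.tau θ s = t := by
    rw [hG.tau_eq, h0, hT1, hT2]
    have : (t + c * N) * Fintype.card V - Fintype.card V * (t + c) =
      Fintype.card V * c * (N - 1) := by ring
    rw [this, div_eq_iff (mul_ne_zero (by positivity) (by linarith))]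
    ring
  rw [htau, hG.avgK3_eq_excessBound_iff (natDegree_quadratic _ _)]
  intro u v huv
  rw [← hs, hent, if_pos huv, eval_sub, eval_C, h0, ← hN, add_sub_cancel_left, mul_one,
    mul_div_cancel_right₀ _ hNpos.ne']

theorem avgK3_eq_of_isDistanceRegular (hG : G.HasFourEigenvalues k θ)
    (hdr : G.IsDistanceRegular) (hsr : (G.distanceGraph 2).IsStronglyRegular) :
    G.avgK3 = G.excessBound θ (s1Poly θ (G.preintersection2 k θ))
        (G.tau θ (s1Poly θ (G.preintersection2 k θ))) ∨
      G.avgK3 = G.excessBound θ (s2Poly θ (G.preintersection2 k θ))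
        (G.tau θ (s2Poly θ (G.preintersection2 k θ))) := by
  obtain ⟨a, c, ha, hrel⟩ := hG.exists_mul_self_of_isDistanceRegular hdr
  rw [hG.preintersection2_eq hrel, s1Poly, s2Poly]
  have hc0 : c ≠ 0 := by linarith [hG.one_le_of_mul_self hrel]
  have hP := distMatrix_two_eq_aeval hc0 hrel
  set P := C c⁻¹ * (X ^ 2 - C a * X - C (k : ℝ)) with hPdef
  obtain ⟨-, -, k', l, m, hsrg⟩ := hsr
  obtain ⟨x, y, z, hxyz⟩ := hsrg.exists_mul_self
  have hroot : ∀ i ≠ 0, P.eval (θ i) ^ 2 - y * P.eval (θ i) - x = 0 := fun i hi => by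
    have := hG.eval_eq_zero_of_aeval_const (p := P ^ 2 - C y * P - C x) (z := z) (fun u v => by
      have := hxyz u v
      rw [adjMatrix_distanceGraph two_ne_zero, hP] at this
      simp only [map_sub, map_mul, aeval_C, pow_two, Algebra.algebraMap_eq_smul_one,
        smul_mul_assoc, one_mul, Matrix.sub_apply, Matrix.smul_apply, smul_eq_mul, this]
      ring) hi
    simpa using this
  -- Values of the quadratic `P` coincide at distinct points only when these are symmetric about `a
  -- / 2`.
  have hadd : ∀ {i j}, i ≠ j → P.eval (θ i) = P.eval (θ j) → θ i + θ j = a := by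
    intro i j hij h
    have hne := sub_ne_zero.2 (hG.strictAnti.injective.ne hij)
    simp only [hPdef, eval_mul, eval_sub, eval_pow, eval_X, eval_C] at h
    have h1 := mul_left_cancel₀ (inv_ne_zero hc0) h
    have h2 : (θ i - θ j) * (θ i + θ j - a) = 0 := by linear_combination h1
    linarith [(mul_eq_zero.1 h2).resolve_left hne]
  have hsum : ∀ {i j}, i ≠ 0 → j ≠ 0 → P.eval (θ i) ≠ P.eval (θ j) →
      P.eval (θ i) + P.eval (θ j) = y := by
    intro i j hi hj h
    have h2 : (P.eval (θ i) - P.eval (θ j)) * (P.eval (θ i) + P.eval (θ j) - y) = 0 := by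
      linear_combination hroot i hi - hroot j hj
    linarith [(mul_eq_zero.1 h2).resolve_left (sub_ne_zero.2 h)]
  by_cases h13 : P.eval (θ 1) = P.eval (θ 3)
  · rw [hadd (by decide) h13]
    exact Or.inl (hG.avgK3_eq_of_mul_self hrel _)
  · by_cases h12 : P.eval (θ 1) = P.eval (θ 2)
    · rw [hadd (by decide) h12]
      exact Or.inr (hG.avgK3_eq_of_mul_self hrel _)
    -- Both other values are now the second root of the quadratic, so `P` agrees at `θ 2` and `θ 3`,
    -- the excluded case.
    · refine (hG.add_ne_of_mul_self ha hrel (hadd (by decide) ?_)).elim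
      linarith [hsum (by decide) (by decide) h12, hsum (by decide) (by decide) h13]

end HasFourEigenvalues

end SimpleGraph

theorem mainTheorem1 {V : Type*} [Fintype V] [DecidableEq V]
    (G : SimpleGraph V) [DecidableRel G.Adj]
    (hconn : G.Connected) (k : ℕ) (hreg : G.IsRegularOfDegree k)
    (θ : Fin 4 → ℝ) (hθ : StrictAnti θ) (hθ0 : θ 0 = k)
    (hspec : spectrum ℝ (G.adjMatrix ℝ) = Set.range θ)
    (n γ₂ τ₁ τ₂ : ℝ) (s₁ s₂ : Polynomial ℝ)
    (hn : n = Fintype.card V)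
    (hγ₂ : γ₂ = G.preintersection2 k θ)
    (hs₁ : s₁ = s1Poly θ γ₂) (hs₂ : s₂ = s2Poly θ γ₂)
    (hτ₁ : τ₁ = G.tau θ s₁) (hτ₂ : τ₂ = G.tau θ s₂) :
    -- the two inequalities
    (G.avgK3 ≤ G.excessBound θ s₁ τ₁ ∧ G.avgK3 ≤ G.excessBound θ s₂ τ₂) ∧
    -- the characterization of equality in at least one of them
    ((G.avgK3 = G.excessBound θ s₁ τ₁ ∨ G.avgK3 = G.excessBound θ s₂ τ₂) ↔
      (G.IsDistanceRegular ∧ (G.distanceGraph 2).IsStronglyRegular)) ∧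
    -- the eigenvalues of the distance-2 graph in each case of equality
    (G.avgK3 = G.excessBound θ s₁ τ₁ →
      (∀ u, (G.k3 u : ℝ) = G.avgK3) ∧
      spectrum ℝ ((G.distanceGraph 2).adjMatrix ℝ) =
        {n - G.avgK3 - θ 0 - 1,
          ((θ 1 - θ 2) * (θ 2 - θ 3) - τ₁) / γ₂,
          -τ₁ / γ₂}) ∧
    (G.avgK3 = G.excessBound θ s₂ τ₂ →
      (∀ u, (G.k3 u : ℝ) = G.avgK3) ∧
      spectrum ℝ ((G.distanceGraph 2).adjMatrix ℝ) =
        {n - G.avgK3 - θ 0 - 1,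
          -τ₂ / γ₂,
          ((θ 1 - θ 3) * (θ 3 - θ 2) - τ₂) / γ₂}) := by
  have hG : G.HasFourEigenvalues k θ := ⟨hconn, hreg, hθ, hθ0, hspec⟩
  subst hn hγ₂ hτ₁ hτ₂ hs₁ hs₂
  have hdeg₁ : (s1Poly θ (G.preintersection2 k θ)).natDegree = 2 :=
    SimpleGraph.natDegree_quadratic _ _
  have hdeg₂ : (s2Poly θ (G.preintersection2 k θ)).natDegree = 2 :=
    SimpleGraph.natDegree_quadratic _ _
  -- The order of listing matters: the last entry plays the role of `γ`.
  have hr₁ : Set.range θ = {θ 0, θ 1, θ 3, θ 2} := by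
    ext x
    simp [Fin.exists_fin_succ, eq_comm]
    tauto
  have hr₂ : Set.range θ = {θ 0, θ 1, θ 2, θ 3} := by
    rw [hr₁, Set.pair_comm]
  have h₁ := hG.consequences_of_avgK3_eq hr₁
    (t := G.tau θ (s1Poly θ (G.preintersection2 k θ)))
  have h₂ := hG.consequences_of_avgK3_eq hr₂
    (t := G.tau θ (s2Poly θ (G.preintersection2 k θ)))
  refine ⟨⟨hG.avgK3_le_excessBound hdeg₁ _, hG.avgK3_le_excessBound hdeg₂ _⟩,
    ⟨fun h => h.elim (fun h => (h₁ h).2.2) fun h => (h₂ h).2.2,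
      fun h => hG.avgK3_eq_of_isDistanceRegular h.1 h.2⟩,
    fun h => ⟨(h₁ h).1, (h₁ h).2.1⟩, fun h => ⟨(h₂ h).1, ?_⟩⟩
  rw [Set.pair_comm]
  exact (h₂ h).2.1
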